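/- Let $X$ be a proper geodesic metric space which is hyperbolic, i.e. for some $\delta>0$ every side of every geodesic triangle in $X$ is contained in the $\delta$-neighbourhood of the union of the other two sides. Let $\partial X$ be its Gromov boundary, and let the isometry group $\mathrm{Iso}(X)$ carry the compact open topology. Let $G<\mathrm{Iso}(X)$ be a closed subgroup with limit set $\Lambda\subset\partial X$ (the set of accumulation points in $\partial X$ of a $G$-orbit in $X$), and assume that $G$ is non-elementary, i.e. that $\Lambda$ has more than two points. Let $H^2_{c}(G,\mathbb R)$ and $H^2_{cb}(G,\mathbb R)$ be the second cohomology groups of the complexes $C(G,\mathbb R)^G\to C(G^2,\mathbb R)^G\to C(G^3,\mathbb R)^G\to\cdots$ and $C_b(G,\mathbb R)^G\to C_b(G^2,\mathbb R)^G\to C_b(G^3,\mathbb R)^G\to\cdots$ of $G$-invariant continuous, respectively bounded continuous, functions with the homogeneous coboundary operator, where $G^{n+1}$ sits in degree $n$. If $G$ acts transitively on the pairs of distinct points of $\Lambda$ (the complement of the diagonal in $\Lambda\times\Lambda$), then the comparison map $H^2_{cb}(G,\mathbb R)\to H^2_c(G,\mathbb R)$ induced by the inclusion of complexes is injective. Moreover,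 every continuous quasimorphism on $G$, i.e. every continuous $q:G\to\mathbb R$ with $\sup_{g,h\in G}|q(g)+q(h)-q(gh)|<\infty$, is bounded. -/

import Mathlib

open Set Filter Topology

/-! ### Geodesic hyperbolic metric spaces -/

namespace HypSpace

/-- `s` is a geodesic segment from `x` to `y`: the image of an isometric embedding of the interval
`[0, dist x y]` which starts at `x` and ends at `y`. -/
def IsGeodesicSegment {X : Type*} [MetricSpace X] (s : Set X) (x y : X) : Prop :=
  ∃ γ : ℝ → X, γ 0 = x ∧ γ (dist x y) = y ∧
    (∀ t ∈ Icc 0 (dist x y), ∀ u ∈ Icc 0 (dist x y), dist (γ t) (γ u) = |t - u|) ∧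
    s = γ '' Icc 0 (dist x y)

/-- Any two points are joined by a geodesic segment. -/
def IsGeodesicSpace (X : Type*) [MetricSpace X] : Prop :=
  ∀ x y : X, ∃ s : Set X, IsGeodesicSegment s x y

/-- The `δ`-thin triangle condition: each side of a geodesic triangle is contained in the
`δ`-neighbourhood of the union of the other two. -/
def HasThinTriangles (X : Type*) [MetricSpace X] (δ : ℝ) : Prop :=
  ∀ (x y z : X) (a b c : Set X), IsGeodesicSegment a x y → IsGeodesicSegment b y z →
    IsGeodesicSegment c z x → a ⊆ Metric.thickening δ (b ∪ c)

/-- A geodesic metric space which is `δ`-hyperbolic for some `δ > 0`. -/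
def IsHyperbolicGeodesicSpace (X : Type*) [MetricSpace X] : Prop :=
  IsGeodesicSpace X ∧ ∃ δ : ℝ, 0 < δ ∧ HasThinTriangles X δ

/-! ### The Gromov boundary -/

/-- The Gromov product `(y, z)_x` of `y` and `z` based at `x`. -/
noncomputable def gromovProduct {X : Type*} [MetricSpace X] (x y z : X) : ℝ :=
  (dist y x + dist z x - dist y z) / 2

/-- `(y_i, y_j)_x → ∞` as `i, j → ∞`. The condition does not depend on the base point `x`. -/
def ConvergesToInfinity {X : Type*} [MetricSpace X] (y : ℕ → X) : Prop :=
  ∀ x : X, Tendsto (fun p : ℕ × ℕ => gromovProduct x (y p.1) (y p.2)) (atTop ×ˢ atTop) atTop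

/-- The sequences in `X` which converge to infinity. -/
def InfSeq (X : Type*) [MetricSpace X] : Type _ := {y : ℕ → X // ConvergesToInfinity y}

/-- `(y_i, z_i)_x → ∞` as `i → ∞`. The condition does not depend on the base point `x`. -/
def InfSeq.Equiv {X : Type*} [MetricSpace X] (y z : InfSeq X) : Prop :=
  ∀ x : X, Tendsto (fun i : ℕ => gromovProduct x (y.1 i) (z.1 i)) atTop atTop

/-- The Gromov boundary: sequences converging to infinity, up to equivalence. (For a hyperbolic
geodesic space `InfSeq.Equiv` is an equivalence relation, so that two sequences define the same
boundary point if and only if they are equivalent.) -/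
def GromovBoundary (X : Type*) [MetricSpace X] : Type _ :=
  Quot (InfSeq.Equiv (X := X))

theorem gromovProduct_isometry {X : Type*} [MetricSpace X] (g : X ≃ᵢ X) (x y z : X) :
    gromovProduct x (g y) (g z) = gromovProduct (g.symm x) y z := by
  have h (w : X) : dist (g w) x = dist w (g.symm x) := by
    rw [← g.dist_eq w (g.symm x), g.apply_symm_apply]
  simp only [gromovProduct, h, g.dist_eq]

/-- Isometries act on sequences converging to infinity, termwise. -/
def InfSeq.map {X : Type*} [MetricSpace X] (g : X ≃ᵢ X) (y : InfSeq X) : InfSeq X :=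
  ⟨fun i => g (y.1 i), fun x => by
    simpa only [gromovProduct_isometry] using y.2 (g.symm x)⟩

/-- The action of an isometry on the Gromov boundary. -/
def GromovBoundary.map {X : Type*} [MetricSpace X] (g : X ≃ᵢ X) :
    GromovBoundary X → GromovBoundary X :=
  Quot.map (InfSeq.map g) fun y z h x => by
    simpa only [InfSeq.map, gromovProduct_isometry] using h (g.symm x)

/-! ### The isometry group and limit sets -/

/-- The compact open topology on the isometry group of `X`. -/
instance isometryTopology (X : Type*) [MetricSpace X] : TopologicalSpace (X ≃ᵢ X) :=
  TopologicalSpace.induced (fun g : X ≃ᵢ X => (⟨g, g.continuous⟩ : C(X, X)))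
    ContinuousMap.compactOpen

/-- The limit set of `G`: the points of the Gromov boundary which are limits of sequences in an
orbit of `G` on `X`. -/
def limitSet {X : Type*} [MetricSpace X] (G : Subgroup (X ≃ᵢ X)) : Set (GromovBoundary X) :=
  {ξ | ∃ (x : X) (y : InfSeq X), (∀ i, ∃ g ∈ G, y.1 i = g x) ∧ Quot.mk _ y = ξ}

/-- `G` is elementary if its limit set consists of at most two points. -/
def IsElementary {X : Type*} [MetricSpace X] (G : Subgroup (X ≃ᵢ X)) : Prop :=
  (limitSet G).encard ≤ 2

/-- `G` acts transitively on the complement of the diagonal in `Λ × Λ`, `Λ` its limit set. -/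
def IsTransitiveOnLimitPairs {X : Type*} [MetricSpace X] (G : Subgroup (X ≃ᵢ X)) : Prop :=
  ∀ a ∈ limitSet G, ∀ b ∈ limitSet G, ∀ c ∈ limitSet G, ∀ d ∈ limitSet G, a ≠ b → c ≠ d →
    ∃ g ∈ G, GromovBoundary.map g a = c ∧ GromovBoundary.map g b = d

end HypSpace

/-! ### Continuous and continuous bounded cohomology with trivial real coefficients -/

namespace ContCohom

/-- The homogeneous coboundary operator
`(d f) (g_0, …, g_{n+1}) = ∑ i, (-1) ^ i * f (g_0, …, g_i omitted, …, g_{n+1})`. -/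
def coboundary (G : Type*) (n : ℕ) :
    ((Fin (n + 1) → G) → ℝ) →ₗ[ℝ] ((Fin (n + 2) → G) → ℝ) where
  toFun f g := ∑ i : Fin (n + 2), (-1) ^ (i : ℕ) * f (fun j => g (i.succAbove j))
  map_add' f f' := by
    funext g
    simp only [Pi.add_apply, mul_add, Finset.sum_add_distrib]
  map_smul' r f := by
    funext g
    simp only [Pi.smul_apply, smul_eq_mul, RingHom.id_apply, Finset.mul_sum]
    exact Finset.sum_congr rfl fun i _ => by ring

/-- `C(G ^ (n + 1), ℝ) ^ G`: the continuous `G`-invariant functions on `G ^ (n + 1)`. -/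
def contCochains (G : Type*) [Group G] [TopologicalSpace G] (n : ℕ) :
    Submodule ℝ ((Fin (n + 1) → G) → ℝ) where
  carrier := {f | Continuous f ∧ ∀ (h : G) (g : Fin (n + 1) → G), f (fun i => h * g i) = f g}
  zero_mem' := ⟨continuous_const, fun _ _ => rfl⟩
  add_mem' := fun {a b} ha hb =>
    ⟨ha.1.add hb.1, fun h g => by simp only [Pi.add_apply, ha.2 h g, hb.2 h g]⟩
  smul_mem' := fun r a ha =>
    ⟨ha.1.const_smul r, fun h g => by simp only [Pi.smul_apply, ha.2 h g]⟩

/-- `C_b(G ^ (n + 1), ℝ) ^ G`: the bounded continuous `G`-invariant functions on `G ^ (n + 1)`. -/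
def bddContCochains (G : Type*) [Group G] [TopologicalSpace G] (n : ℕ) :
    Submodule ℝ ((Fin (n + 1) → G) → ℝ) where
  carrier := {f | f ∈ contCochains G n ∧ ∃ C : ℝ, ∀ g, |f g| ≤ C}
  zero_mem' := ⟨Submodule.zero_mem _, 0, fun _ => by simp⟩
  add_mem' := fun {a b} ha hb => by
    obtain ⟨ha, A, hA⟩ := ha
    obtain ⟨hb, B, hB⟩ := hb
    exact ⟨Submodule.add_mem _ ha hb, A + B, fun g =>
      (abs_add_le _ _).trans (add_le_add (hA g) (hB g))⟩
  smul_mem' := fun r a ha => by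
    obtain ⟨ha, A, hA⟩ := ha
    refine ⟨Submodule.smul_mem _ r ha, |r| * A, fun g => ?_⟩
    simp only [Pi.smul_apply, smul_eq_mul, abs_mul]
    exact mul_le_mul_of_nonneg_left (hA g) (abs_nonneg r)

theorem bddContCochains_le (G : Type*) [Group G] [TopologicalSpace G] (n : ℕ) :
    bddContCochains G n ≤ contCochains G n := fun _ hf => hf.1

/-- The `n`-cocycles of a complex of cochain spaces `S`. -/
def cocycles {G : Type*} (S : ∀ n : ℕ, Submodule ℝ ((Fin (n + 1) → G) → ℝ)) (n : ℕ) :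
    Submodule ℝ ((Fin (n + 1) → G) → ℝ) :=
  S n ⊓ LinearMap.ker (coboundary G n)

/-- The `n`-coboundaries of a complex of cochain spaces `S`. -/
def coboundaries {G : Type*} (S : ∀ n : ℕ, Submodule ℝ ((Fin (n + 1) → G) → ℝ)) :
    ∀ n : ℕ, Submodule ℝ ((Fin (n + 1) → G) → ℝ)
  | 0 => ⊥
  | n + 1 => (S n).map (coboundary G n)

/-- The `n`-th cohomology of a complex of cochain spaces `S`: cocycles modulo coboundaries. -/
abbrev cohomology {G : Type*} (S : ∀ n : ℕ, Submodule ℝ ((Fin (n + 1) → G) → ℝ)) (n : ℕ) :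
    Type _ :=
  cocycles S n ⧸ (coboundaries S n).submoduleOf (cocycles S n)

/-- The continuous cohomology `H_c^n(G, ℝ)`. -/
abbrev Hc (G : Type*) [Group G] [TopologicalSpace G] (n : ℕ) : Type _ :=
  cohomology (contCochains G) n

/-- The continuous bounded cohomology `H_cb^n(G, ℝ)`. -/
abbrev Hcb (G : Type*) [Group G] [TopologicalSpace G] (n : ℕ) : Type _ :=
  cohomology (bddContCochains G) n

theorem cocycles_mono {G : Type*} {S T : ∀ n : ℕ, Submodule ℝ ((Fin (n + 1) → G) → ℝ)}
    (h : ∀ n, S n ≤ T n) (n : ℕ) : cocycles S n ≤ cocycles T n :=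
  inf_le_inf_right _ (h n)

theorem coboundaries_mono {G : Type*} {S T : ∀ n : ℕ, Submodule ℝ ((Fin (n + 1) → G) → ℝ)}
    (h : ∀ n, S n ≤ T n) : ∀ n : ℕ, coboundaries S n ≤ coboundaries T n
  | 0 => le_rfl
  | n + 1 => Submodule.map_mono (h n)

/-- The comparison map `H_cb^n(G, ℝ) → H_c^n(G, ℝ)`, induced by the inclusion of the bounded
continuous cochains into the continuous cochains. -/
def comparison (G : Type*) [Group G] [TopologicalSpace G] (n : ℕ) : Hcb G n →ₗ[ℝ] Hc G n :=
  Submodule.mapQ _ _ (Submodule.inclusion (cocycles_mono (bddContCochains_le G) n))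
    fun _ hf => coboundaries_mono (bddContCochains_le G) n hf

/-- A continuous quasimorphism on `G`: `q` is continuous and
`sup_{g, h} |q g + q h - q (g * h)| < ∞`. -/
def IsContQuasimorphism {G : Type*} [Group G] [TopologicalSpace G] (q : G → ℝ) : Prop :=
  Continuous q ∧ ∃ D : ℝ, ∀ g h : G, |q g + q h - q (g * h)| ≤ D

end ContCohom

/-!
The proof works with Gromov products throughout: thin triangles enter only through the four point
inequality (`fourPoint_of_hasThinTriangles`), and no geodesic lines and no topology on the boundary
are used.

Fix a base point `x₀`. Two distinct limit points yield a loxodromic element `h` of `G`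
(`exists_isAxial`): if neither `g` nor `f` is loxodromic, each of them moves `x₀` in about the same
direction as its inverse does, so if `g x₀` and `f x₀` lie far out in different directions then
`g f` is loxodromic. Let `h⁺`, `h⁻` be the fixed points of `h`.

* Given `g` in `G` with `x₀` and `g x₀` far apart, one of `h⁺`, `h⁻` is not in the direction of
  `g x₀` as seen from `x₀`, and one of `g h⁺`, `g h⁻` is not in the direction of `x₀` as seen
  from `g x₀`. By transitivity on pairs some translate of the orbit `hⁿ x₀` joins these two limit
  points, so it passes near `x₀` and near `g x₀` (`IsAxial.exists_translate`). Hence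
  `G = K ⟨h⟩ K` with `K = {g | d (g x₀, x₀) ≤ R}`, which is compact since `G` is closed and `X` is
  proper (`isCompact_setOf_dist_le_of_isClosed`).
* By transitivity some `s` in `G` maps `(h⁺, h⁻)` to `(h⁻, h⁺)`, and then `hⁿ s hⁿ` moves `x₀` by a
  bounded amount (`IsAxial.exists_swap`).

A continuous quasimorphism `q` is bounded on compact sets. As `q (hⁿ s hⁿ)` is `2 q (hⁿ) + q s` up
to a bounded error, `q` is bounded on the powers of `h`, and so on `K ⟨h⟩ K = G`
(`IsContQuasimorphism.bounded`). If a bounded two-cocycle is the coboundary of a continuous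
invariant `β`, then `g ↦ β (1, g)` is a quasimorphism, hence bounded, so that `β` itself is a
bounded primitive (`comparison_injective_of_bounded`).
-/

namespace HypSpace

/-! ### The Gromov product -/

section GromovProduct

variable {X : Type*} [MetricSpace X]

theorem gromovProduct_comm (x y z : X) : gromovProduct x y z = gromovProduct x z y := by
  simp only [gromovProduct, dist_comm y z]; ring

theorem gromovProduct_map (g : X ≃ᵢ X) (x y z : X) :
    gromovProduct (g x) (g y) (g z) = gromovProduct x y z := by
  simp only [gromovProduct, g.dist_eq]

theorem gromovProduct_nonneg (x y z : X) : 0 ≤ gromovProduct x y z := by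
  have := dist_triangle_right y z x
  simp only [gromovProduct]; linarith

theorem gromovProduct_self (x y : X) : gromovProduct x y y = dist y x := by
  simp [gromovProduct]

theorem gromovProduct_base_right (x y : X) : gromovProduct x y x = 0 := by
  simp [gromovProduct]

theorem gromovProduct_add_swap (x y z : X) :
    gromovProduct x y z + gromovProduct y x z = dist x y := by
  simp only [gromovProduct, dist_comm y x, dist_comm z x, dist_comm z y]; ring

theorem gromovProduct_le_add_dist_base (x x' y z : X) :
    gromovProduct x y z ≤ gromovProduct x' y z + dist x x' := by
  have := dist_triangle_right y x x'
  have := dist_triangle_right z x x'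
  simp only [gromovProduct]; linarith

theorem gromovProduct_le_add_dist_right (x y z z' : X) :
    gromovProduct x y z ≤ gromovProduct x y z' + dist z z' := by
  have := dist_triangle z z' x
  have := dist_triangle_right y z' z
  have := dist_comm z z'
  simp only [gromovProduct]; linarith

theorem gromovProduct_le_add_dist_left (x y y' z : X) :
    gromovProduct x y z ≤ gromovProduct x y' z + dist y y' := by
  rw [gromovProduct_comm x y, gromovProduct_comm x y']
  exact gromovProduct_le_add_dist_right x z y y'

end GromovProduct

/-! ### The four point inequality -/

section FourPoint

/-- Gromov's four point condition, up to the additive error `δ`: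
`min (x, y)_w (y, z)_w ≤ (x, z)_w + δ`. -/
def FourPoint (X : Type*) [MetricSpace X] (δ : ℝ) : Prop :=
  ∀ w x y z : X, min (gromovProduct w x y) (gromovProduct w y z) ≤ gromovProduct w x z + δ

variable {X : Type*} [MetricSpace X]

theorem FourPoint.right_le {δ B : ℝ} (hδ : FourPoint X δ) {w x y z : X}
    (h : gromovProduct w x z ≤ B) (h' : B + δ < gromovProduct w x y) :
    gromovProduct w y z ≤ B + δ := by
  rcases min_le_iff.1 (hδ w x y z) with h1 | h1 <;> linarith

theorem FourPoint.left_le {δ B : ℝ} (hδ : FourPoint X δ) {w x y z : X}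
    (h : gromovProduct w x z ≤ B) (h' : B + δ < gromovProduct w y z) :
    gromovProduct w x y ≤ B + δ := by
  rcases min_le_iff.1 (hδ w x y z) with h1 | h1 <;> linarith

theorem FourPoint.le {δ B : ℝ} (hδ : FourPoint X δ) {w x y z : X}
    (h : B ≤ gromovProduct w x y) (h' : B ≤ gromovProduct w y z) :
    B - δ ≤ gromovProduct w x z := by
  rcases min_le_iff.1 (hδ w x y z) with h1 | h1 <;> linarith

theorem IsGeodesicSegment.dist_add_dist {s : Set X} {x y p : X} (hs : IsGeodesicSegment s x y)
    (hp : p ∈ s) : dist x p + dist p y = dist x y := by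
  obtain ⟨γ, h0, h1, hγ, rfl⟩ := hs
  obtain ⟨t, ht, rfl⟩ := hp
  have e0 := hγ 0 ⟨le_rfl, dist_nonneg⟩ t ht
  have e1 := hγ t ht _ ⟨dist_nonneg, le_rfl⟩
  rw [h0] at e0
  rw [h1] at e1
  rw [e0, e1, zero_sub, abs_neg, abs_of_nonneg ht.1, abs_sub_comm,
    abs_of_nonneg (sub_nonneg.2 ht.2)]
  ring

theorem IsGeodesicSegment.left_mem {s : Set X} {x y : X} (hs : IsGeodesicSegment s x y) :
    x ∈ s := by
  obtain ⟨γ, h0, h1, hγ, rfl⟩ := hs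
  exact ⟨0, ⟨le_rfl, dist_nonneg⟩, h0⟩

theorem IsGeodesicSegment.right_mem {s : Set X} {x y : X} (hs : IsGeodesicSegment s x y) :
    y ∈ s := by
  obtain ⟨γ, h0, h1, hγ, rfl⟩ := hs
  exact ⟨_, ⟨dist_nonneg, le_rfl⟩, h1⟩

theorem IsGeodesicSegment.isPreconnected {s : Set X} {x y : X} (hs : IsGeodesicSegment s x y) :
    IsPreconnected s := by
  obtain ⟨γ, h0, h1, hγ, rfl⟩ := hs
  refine isPreconnected_Icc.image γ (Metric.continuousOn_iff.2 fun t ht ε hε => ⟨ε, hε, ?_⟩)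
  intro u hu hut
  rwa [hγ u hu t ht]

theorem gromovProduct_le_dist_of_mem {s : Set X} {w x y p : X} (hs : IsGeodesicSegment s x y)
    (hp : p ∈ s) : gromovProduct w x y ≤ dist w p := by
  have := hs.dist_add_dist hp
  have := dist_triangle x p w
  have := dist_triangle y p w
  have := dist_comm w p
  have := dist_comm y p
  simp only [gromovProduct]; linarith

/-- The side of a thin triangle opposite to `w` comes `2 δ`-close to realizing the Gromov product:
by connectedness it has a point which is close to both of the other sides. -/
theorem exists_mem_dist_le_gromovProduct {δ : ℝ} (hg : IsGeodesicSpace X) (hpos : 0 < δ)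
    (hthin : HasThinTriangles X δ) {s : Set X} {x y : X} (hs : IsGeodesicSegment s x y) (w : X) :
    ∃ p ∈ s, dist w p ≤ gromovProduct w x y + 2 * δ := by
  obtain ⟨b, hb⟩ := hg y w
  obtain ⟨c, hc⟩ := hg w x
  have hcov : s ⊆ Metric.thickening δ b ∪ Metric.thickening δ c := by
    rw [← Metric.thickening_union]
    exact hthin x y w s b c hs hb hc
  obtain ⟨p, hps, hpb, hpc⟩ := hs.isPreconnected _ _ Metric.isOpen_thickening
    Metric.isOpen_thickening hcov
    ⟨y, hs.right_mem, Metric.self_subset_thickening hpos _ hb.left_mem⟩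
    ⟨x, hs.left_mem, Metric.self_subset_thickening hpos _ hc.right_mem⟩
  refine ⟨p, hps, ?_⟩
  obtain ⟨u, hu, hpu⟩ := Metric.mem_thickening_iff.1 hpb
  obtain ⟨v, hv, hpv⟩ := Metric.mem_thickening_iff.1 hpc
  have e1 := hb.dist_add_dist hu
  have e2 := hc.dist_add_dist hv
  have e3 := hs.dist_add_dist hps
  have := dist_triangle_right p w u
  have := dist_triangle_left w p v
  have := dist_triangle p u y
  have := dist_triangle p v x
  simp only [gromovProduct]
  simp only [dist_comm] at *
  linarith

theorem fourPoint_of_hasThinTriangles {δ : ℝ} (hg : IsGeodesicSpace X) (hpos : 0 < δ)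
    (hthin : HasThinTriangles X δ) : FourPoint X (3 * δ) := by
  intro w x y z
  obtain ⟨a, ha⟩ := hg x z
  obtain ⟨b, hb⟩ := hg z y
  obtain ⟨c, hc⟩ := hg y x
  obtain ⟨p, hpa, hp⟩ := exists_mem_dist_le_gromovProduct hg hpos hthin ha w
  obtain ⟨r, hr, hpr⟩ := Metric.mem_thickening_iff.1 (hthin x z y a b c ha hb hc hpa)
  have := dist_triangle w p r
  rcases hr with hr | hr
  · have := gromovProduct_le_dist_of_mem (w := w) hb hr
    rw [gromovProduct_comm] at this
    exact (min_le_right _ _).trans (by linarith)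
  · have := gromovProduct_le_dist_of_mem (w := w) hc hr
    rw [gromovProduct_comm] at this
    exact (min_le_left _ _).trans (by linarith)

end FourPoint

/-! ### Equality of boundary points -/

section Boundary

variable {X : Type*} [MetricSpace X]

theorem InfSeq.equiv_refl (y : InfSeq X) : InfSeq.Equiv y y := fun x =>
  (y.2 x).comp (tendsto_id.prodMk tendsto_id)

theorem InfSeq.Equiv.symm {y z : InfSeq X} (h : InfSeq.Equiv y z) : InfSeq.Equiv z y := fun x => by
  simpa only [gromovProduct_comm x] using h x

theorem InfSeq.Equiv.trans {δ : ℝ} (hδ : FourPoint X δ) {y z w : InfSeq X}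
    (h : InfSeq.Equiv y z) (h' : InfSeq.Equiv z w) : InfSeq.Equiv y w := fun x => by
  refine tendsto_atTop.2 fun B => ?_
  filter_upwards [(h x).eventually_ge_atTop (B + δ),
    (h' x).eventually_ge_atTop (B + δ)] with n h1 h2
  simpa using hδ.le h1 h2

theorem InfSeq.mk_eq_iff {δ : ℝ} (hδ : FourPoint X δ) {y z : InfSeq X} :
    (Quot.mk _ y : GromovBoundary X) = Quot.mk _ z ↔ InfSeq.Equiv y z := by
  refine ⟨fun h => ?_, fun h => Quot.sound h⟩
  have hgen := Quot.eqvGen_exact h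
  clear h
  induction hgen with
  | rel _ _ h => exact h
  | refl y => exact y.equiv_refl
  | symm _ _ _ h => exact h.symm
  | trans _ _ _ _ _ h h' => exact h.trans hδ h'

theorem ConvergesToInfinity.tendsto_dist {y : ℕ → X} (hy : ConvergesToInfinity y) (x : X) :
    Tendsto (fun i => dist (y i) x) atTop atTop := by
  have := (hy x).comp (tendsto_id.prodMk tendsto_id)
  simpa [Function.comp_def, gromovProduct_self] using this

end Boundary

/-! ### Axial isometries -/

section Axial

variable {X : Type*} [MetricSpace X]

/-- The orbit of `x₀` under the powers of `h` is a quasigeodesic line: `(h⁻ᵐ x₀, hⁿ x₀)_{x₀}` is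
bounded by `C` for `m, n ≥ 0`, and `hⁿ x₀` leaves every ball. Thus `h` is a loxodromic isometry;
the condition is phrased through Gromov products, so that neither geodesic lines nor the
Morse lemma are needed. -/
structure IsAxial (x₀ : X) (C : ℝ) (h : X ≃ᵢ X) : Prop where
  gromovProduct_le : ∀ m n : ℕ, gromovProduct x₀ ((h⁻¹ ^ m) x₀) ((h ^ n) x₀) ≤ C
  tendsto_dist : Tendsto (fun n : ℕ => dist ((h ^ n) x₀) x₀) atTop atTop

variable {x₀ : X} {C δ : ℝ} {h : X ≃ᵢ X}

theorem dist_inv_apply (g : X ≃ᵢ X) (x y : X) : dist (g⁻¹ x) y = dist x (g y) := by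
  rw [← g.dist_eq, IsometryEquiv.apply_inv_self]

theorem dist_inv_self (g : X ≃ᵢ X) (x : X) : dist (g⁻¹ x) x = dist (g x) x := by
  rw [dist_inv_apply, dist_comm]

theorem gromovProduct_inv_apply (g : X ≃ᵢ X) (x y z : X) :
    gromovProduct (g x) y z = gromovProduct x (g⁻¹ y) (g⁻¹ z) := by
  rw [← gromovProduct_map g x, IsometryEquiv.apply_inv_self, IsometryEquiv.apply_inv_self]

theorem IsAxial.inv (hh : IsAxial x₀ C h) : IsAxial x₀ C h⁻¹ where
  gromovProduct_le m n := by
    rw [inv_inv, gromovProduct_comm]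
    exact hh.gromovProduct_le n m
  tendsto_dist := by
    simpa only [inv_pow, dist_inv_self] using hh.tendsto_dist

theorem IsAxial.gromovProduct_zpow_le (hh : IsAxial x₀ C h) {i j k : ℤ} (hij : i ≤ j)
    (hjk : j ≤ k) : gromovProduct ((h ^ j) x₀) ((h ^ i) x₀) ((h ^ k) x₀) ≤ C := by
  obtain ⟨m, hm⟩ := Int.eq_ofNat_of_zero_le (sub_nonneg.2 hij)
  obtain ⟨n, hn⟩ := Int.eq_ofNat_of_zero_le (sub_nonneg.2 hjk)
  have := hh.gromovProduct_le m n
  rw [gromovProduct_inv_apply, ← IsometryEquiv.mul_apply, ← IsometryEquiv.mul_apply, ← zpow_neg,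
    ← zpow_add, ← zpow_add]
  convert this using 4
  · rw [inv_pow, ← zpow_natCast, ← zpow_neg]; congr 1; omega
  · rw [← zpow_natCast]; congr 1; omega

theorem IsAxial.le_gromovProduct (hh : IsAxial x₀ C h) {m n : ℕ} (hmn : m ≤ n) :
    dist ((h ^ m) x₀) x₀ - C ≤ gromovProduct x₀ ((h ^ m) x₀) ((h ^ n) x₀) := by
  have h1 := hh.gromovProduct_zpow_le (i := 0) (j := m) (k := n) (by omega) (by omega)
  have h2 := gromovProduct_add_swap x₀ ((h ^ m) x₀) ((h ^ n) x₀)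
  simp only [zpow_natCast, zpow_zero, IsometryEquiv.coe_one, id] at h1
  rw [dist_comm] at h2
  linarith

theorem IsAxial.convergesToInfinity (hh : IsAxial x₀ C h) :
    ConvergesToInfinity fun n : ℕ => (h ^ n) x₀ := by
  intro x
  refine tendsto_atTop.2 fun B => ?_
  have h1 := hh.tendsto_dist.eventually_ge_atTop (B + C + dist x₀ x)
  filter_upwards [h1.prod_mk h1] with p hp
  have := gromovProduct_le_add_dist_base x₀ x ((h ^ p.1) x₀) ((h ^ p.2) x₀)
  rcases le_total p.1 p.2 with hle | hle
  · have := hh.le_gromovProduct hle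
    linarith [hp.1]
  · have := hh.le_gromovProduct hle
    rw [gromovProduct_comm] at this
    linarith [hp.2]

/-- The attracting fixed point of an axial isometry. -/
def IsAxial.point (hh : IsAxial x₀ C h) : GromovBoundary X :=
  Quot.mk _ ⟨fun n : ℕ => (h ^ n) x₀, hh.convergesToInfinity⟩

theorem IsAxial.map_point_mem {G : Subgroup (X ≃ᵢ X)} (hh : IsAxial x₀ C h) (hG : h ∈ G)
    {g : X ≃ᵢ X} (hg : g ∈ G) : GromovBoundary.map g hh.point ∈ limitSet G :=
  ⟨x₀, _, fun n => ⟨g * h ^ n, G.mul_mem hg (G.pow_mem hG n), rfl⟩, rfl⟩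

theorem IsAxial.point_mem {G : Subgroup (X ≃ᵢ X)} (hh : IsAxial x₀ C h) (hG : h ∈ G) :
    hh.point ∈ limitSet G :=
  ⟨x₀, _, fun n => ⟨h ^ n, G.pow_mem hG n, rfl⟩, rfl⟩

/-- If `h` moves `x₀` far compared with `(h⁻¹ x₀, h x₀)_{x₀}`, then `h` is axial: a local-to-global
principle for the broken path through the points `hⁿ x₀`, proved by induction on `n`. -/
theorem isAxial_of_lt (hδ : FourPoint X δ) (hpos : 0 < δ)
    (hlt : 2 * gromovProduct x₀ (h⁻¹ x₀) (h x₀) + 3 * δ < dist (h x₀) x₀) :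
    IsAxial x₀ (gromovProduct x₀ (h⁻¹ x₀) (h x₀) + 2 * δ) h := by
  -- The bound for `m = 1`, for an arbitrary isometry, so that it also applies to `h⁻¹`.
  have key : ∀ h : X ≃ᵢ X, 2 * gromovProduct x₀ (h⁻¹ x₀) (h x₀) + 3 * δ < dist (h x₀) x₀ →
      ∀ n : ℕ, gromovProduct x₀ (h⁻¹ x₀) ((h ^ n) x₀) ≤ gromovProduct x₀ (h⁻¹ x₀) (h x₀) + δ ∧
        dist (h x₀) x₀ - gromovProduct x₀ (h⁻¹ x₀) (h x₀) - δ ≤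
          gromovProduct x₀ ((h ^ (n + 1)) x₀) (h x₀) := by
    intro h hlt n
    have step : ∀ n : ℕ,
        gromovProduct x₀ (h⁻¹ x₀) ((h ^ n) x₀) ≤ gromovProduct x₀ (h⁻¹ x₀) (h x₀) + δ →
        dist (h x₀) x₀ - gromovProduct x₀ (h⁻¹ x₀) (h x₀) - δ ≤
          gromovProduct x₀ ((h ^ (n + 1)) x₀) (h x₀) := by
      intro n hn
      have h1 := gromovProduct_add_swap x₀ (h x₀) ((h ^ (n + 1)) x₀)
      rw [gromovProduct_inv_apply h, pow_succ', IsometryEquiv.mul_apply,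
        IsometryEquiv.inv_apply_self, ← IsometryEquiv.mul_apply, ← pow_succ', dist_comm,
        gromovProduct_comm x₀ (h x₀)] at h1
      linarith
    have main : gromovProduct x₀ (h⁻¹ x₀) ((h ^ n) x₀) ≤
        gromovProduct x₀ (h⁻¹ x₀) (h x₀) + δ := by
      induction n with
      | zero =>
        rw [pow_zero, IsometryEquiv.coe_one, id, gromovProduct_base_right]
        linarith [gromovProduct_nonneg x₀ (h⁻¹ x₀) (h x₀)]
      | succ n ih =>
        have := step n ih
        exact hδ.left_le le_rfl (by linarith)
    exact ⟨main, step n main⟩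
  have key' := key h⁻¹ (by rwa [inv_inv, gromovProduct_comm, dist_inv_self])
  simp only [inv_inv, gromovProduct_comm x₀ (h x₀)] at key'
  have hnn := gromovProduct_nonneg x₀ (h⁻¹ x₀) (h x₀)
  refine ⟨fun m n => ?_, ?_⟩
  · rcases n with _ | n
    · rw [pow_zero, IsometryEquiv.coe_one, id, gromovProduct_base_right]
      linarith
    · have h1 := (key h hlt n).2
      have h2 := hδ.left_le (key' m).1 (y := (h ^ (n + 1)) x₀) (by linarith)
      linarith
  · refine tendsto_atTop_mono (f := fun n : ℕ => (n : ℝ) * δ) (fun n => ?_)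
      (tendsto_natCast_atTop_atTop.atTop_mul_const hpos)
    induction n with
    | zero => simp
    | succ n ih =>
      have h1 := (key h hlt n).1
      have h2 : dist (h⁻¹ x₀) ((h ^ n) x₀) = dist ((h ^ (n + 1)) x₀) x₀ := by
        rw [dist_inv_apply, ← IsometryEquiv.mul_apply, ← pow_succ', dist_comm]
      have h3 := dist_inv_self h x₀
      have h4 : 2 * gromovProduct x₀ (h⁻¹ x₀) ((h ^ n) x₀) =
          dist (h x₀) x₀ + dist ((h ^ n) x₀) x₀ - dist ((h ^ (n + 1)) x₀) x₀ := by
        rw [← h2, ← h3, gromovProduct]; ring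
      push_cast
      linarith

/-- Either one of `g`, `h` is axial, or both almost fix a direction, and then `g * h` is axial. -/
theorem exists_isAxial_of_gromovProduct_le (hδ : FourPoint X δ) (hpos : 0 < δ)
    {G : Subgroup (X ≃ᵢ X)} {g h : X ≃ᵢ X} (hg : g ∈ G) (hh : h ∈ G) {B : ℝ}
    (hB : gromovProduct x₀ (g x₀) (h x₀) ≤ B) (hgB : 4 * B + 20 * δ < dist (g x₀) x₀)
    (hhB : 4 * B + 20 * δ < dist (h x₀) x₀) : ∃ f ∈ G, ∃ C, IsAxial x₀ C f := by
  by_contra! hno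
  have hsmall : ∀ f ∈ G, dist (f x₀) x₀ ≤ 2 * gromovProduct x₀ (f⁻¹ x₀) (f x₀) + 3 * δ :=
    fun f hf => not_lt.1 fun hlt => hno f hf _ (isAxial_of_lt hδ hpos hlt)
  have hB0 := (gromovProduct_nonneg x₀ (g x₀) (h x₀)).trans hB
  have hg1 := hsmall g hg
  have hh1 := hsmall h hh
  have hgh1 := hsmall (g * h) (G.mul_mem hg hh)
  have h1 : gromovProduct x₀ (g⁻¹ x₀) (h x₀) ≤ B + δ :=
    hδ.right_le hB (by rw [gromovProduct_comm]; linarith)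
  have d1 : dist (g⁻¹ x₀) (h x₀) = dist ((g * h) x₀) x₀ := by
    rw [dist_inv_apply, IsometryEquiv.mul_apply, dist_comm]
  have d2 := dist_inv_self g x₀
  have d3 := dist_inv_self h x₀
  have d4 := dist_inv_self (g * h) x₀
  have d5 : dist ((g * h) x₀) (g x₀) = dist (h x₀) x₀ := by
    rw [IsometryEquiv.mul_apply, g.dist_eq]
  have d6 : dist ((g * h)⁻¹ x₀) (h⁻¹ x₀) = dist (g x₀) x₀ := by
    rw [dist_inv_apply, IsometryEquiv.mul_apply, IsometryEquiv.apply_inv_self, dist_comm]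
  have h2 : dist (g x₀) x₀ - B - δ ≤ gromovProduct x₀ (g x₀) ((g * h) x₀) := by
    rw [gromovProduct_comm]
    simp only [gromovProduct] at h1 ⊢
    linarith
  have h3 : dist (h x₀) x₀ - B - δ ≤ gromovProduct x₀ ((g * h)⁻¹ x₀) (h⁻¹ x₀) := by
    simp only [gromovProduct] at h1 ⊢
    linarith
  have h4 : dist (h x₀) x₀ / 2 - B - 3 * δ ≤ gromovProduct x₀ ((g * h)⁻¹ x₀) (h x₀) := by
    have := hδ.le (B := dist (h x₀) x₀ / 2 - B - 2 * δ) (w := x₀) (x := (g * h)⁻¹ x₀)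
      (y := h⁻¹ x₀) (z := h x₀) (by linarith) (by linarith)
    linarith
  have h5 : gromovProduct x₀ ((g * h) x₀) (h x₀) ≤ B + δ := hδ.right_le hB (by linarith)
  have h6 : gromovProduct x₀ ((g * h)⁻¹ x₀) ((g * h) x₀) ≤ B + δ + δ := by
    rw [gromovProduct_comm]
    exact hδ.left_le h5 (by linarith)
  have h7 : gromovProduct x₀ (g⁻¹ x₀) (h x₀) * 2 =
      dist (g x₀) x₀ + dist (h x₀) x₀ - dist ((g * h) x₀) x₀ := by
    rw [← d1, ← d2, gromovProduct]; ring
  linarith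

/-- A group with two limit points contains an axial isometry. -/
theorem exists_isAxial (hδ : FourPoint X δ) (hpos : 0 < δ) {G : Subgroup (X ≃ᵢ X)}
    {ξ η : GromovBoundary X} (hξ : ξ ∈ limitSet G) (hη : η ∈ limitSet G) (hne : ξ ≠ η) (x₀ : X) :
    ∃ f ∈ G, ∃ C, IsAxial x₀ C f := by
  obtain ⟨x, y, hy, rfl⟩ := hξ
  obtain ⟨x', z, hz, rfl⟩ := hη
  choose g hg hgy using hy
  choose h hh hhz using hz
  replace hne := mt (InfSeq.mk_eq_iff hδ).2 hne
  simp only [InfSeq.Equiv, tendsto_atTop, not_forall, not_eventually, not_le] at hne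
  obtain ⟨w, B, hB⟩ := hne
  -- Passing from the base points `x`, `x'`, `w` to `x₀` changes the Gromov products by at most
  -- the distances involved.
  set B' := B + dist x₀ w + dist x₀ x + dist x₀ x' with hB'
  obtain ⟨i, hi, hi1, hi2⟩ := (hB.and_eventually
    (((y.2.tendsto_dist x₀).eventually_gt_atTop (4 * B' + 20 * δ + dist x₀ x)).and
    ((z.2.tendsto_dist x₀).eventually_gt_atTop (4 * B' + 20 * δ + dist x₀ x')))).exists
  rw [hgy] at hi hi1
  rw [hhz] at hi hi2
  have e1 := (g i).dist_eq x₀ x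
  have e2 := (h i).dist_eq x₀ x'
  have e3 := dist_triangle_left (g i x) x₀ (g i x₀)
  have e4 := dist_triangle_left (h i x') x₀ (h i x₀)
  have t1 := gromovProduct_le_add_dist_base x₀ w (g i x₀) (h i x₀)
  have t2 := gromovProduct_le_add_dist_left w (g i x₀) (g i x) (h i x₀)
  have t3 := gromovProduct_le_add_dist_right w (g i x) (h i x₀) (h i x')
  exact exists_isAxial_of_gromovProduct_le hδ hpos (hg i) (hh i) (B := B') (by linarith)
    (by linarith) (by linarith)

end Axial

/-! ### Points close to the axis -/

section Axis

variable {X : Type*} [MetricSpace X] {x₀ : X} {C δ : ℝ} {h : X ≃ᵢ X}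

/-- A point which sees the ends of a long piece of the orbit of `h` at a small Gromov product is
close to the orbit. -/
theorem IsAxial.exists_dist_le (hδ : FourPoint X δ) (hpos : 0 < δ) (hh : IsAxial x₀ C h) {y : X}
    {N : ℕ} {B : ℝ} (hB : gromovProduct y ((h ^ N) x₀) ((h⁻¹ ^ N) x₀) ≤ B) :
    ∃ j : ℤ, dist y ((h ^ j) x₀) ≤ 2 * (B + δ + dist (h x₀) x₀) + C := by
  have hB0 := (gromovProduct_nonneg _ _ _).trans hB
  have hC0 := (gromovProduct_nonneg _ _ _).trans (hh.gromovProduct_le 0 0)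
  have hl := dist_nonneg (x := h x₀) (y := x₀)
  rw [inv_pow, ← zpow_natCast, ← zpow_neg] at hB
  by_cases hN : gromovProduct y ((h ^ (N : ℤ)) x₀) ((h ^ (N : ℤ)) x₀) ≤ B + δ
  · refine ⟨N, ?_⟩
    rw [gromovProduct_self, dist_comm] at hN
    linarith
  -- `i` is an index at which the orbit turns from the end `h⁻ᴺ x₀` to the end `hᴺ x₀`, as seen
  -- from `y`.
  obtain ⟨i, hi1, hi2, hi3, hi4⟩ : ∃ i : ℤ, -(N : ℤ) ≤ i ∧ i < N ∧
      gromovProduct y ((h ^ (N : ℤ)) x₀) ((h ^ i) x₀) ≤ B + δ ∧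
      ¬ gromovProduct y ((h ^ (N : ℤ)) x₀) ((h ^ (i + 1)) x₀) ≤ B + δ := by
    by_contra! hcon
    have : ∀ k : ℕ, -(N : ℤ) + k ≤ N →
        gromovProduct y ((h ^ (N : ℤ)) x₀) ((h ^ (-(N : ℤ) + k)) x₀) ≤ B + δ := by
      intro k
      induction k with
      | zero => intro _; simp only [Nat.cast_zero, add_zero]; linarith
      | succ k ih =>
        intro hk
        push_cast at hk ⊢
        rw [← add_assoc] at hk ⊢
        exact hcon _ (by omega) (by omega) (ih (by omega))
    have h2 := this (2 * N) (by push_cast; omega)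
    rw [show -(N : ℤ) + ((2 * N : ℕ) : ℤ) = N by push_cast; ring] at h2
    exact hN h2
  refine ⟨i, ?_⟩
  have h1 : gromovProduct y ((h ^ (i + 1)) x₀) ((h ^ (-(N : ℤ))) x₀) ≤ B + δ :=
    hδ.right_le hB (not_le.1 hi4)
  have h2 := gromovProduct_le_add_dist_left y ((h ^ i) x₀) ((h ^ (i + 1)) x₀)
    ((h ^ (-(N : ℤ))) x₀)
  have h3 : dist ((h ^ i) x₀) ((h ^ (i + 1)) x₀) = dist (h x₀) x₀ := by
    rw [zpow_add_one, IsometryEquiv.mul_apply, IsometryEquiv.dist_eq, dist_comm]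
  have h4 := hh.gromovProduct_zpow_le hi1 hi2.le
  have h5 := dist_triangle_right ((h ^ (N : ℤ)) x₀) ((h ^ (-(N : ℤ))) x₀) y
  simp only [gromovProduct] at h1 h2 h4 hi3
  simp only [dist_comm] at *
  linarith

/-- Of the two ends of the axis at least one is not seen from `x₀` in the direction of `p`. -/
theorem IsAxial.exists_forall_gromovProduct_le (hδ : FourPoint X δ) (hh : IsAxial x₀ C h) (p : X) :
    ∃ k : X ≃ᵢ X, (k = h ∨ k = h⁻¹) ∧ ∀ n : ℕ, gromovProduct x₀ ((k ^ n) x₀) p ≤ C + δ := by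
  by_cases hp : ∀ n : ℕ, gromovProduct x₀ ((h ^ n) x₀) p ≤ C + δ
  · exact ⟨h, .inl rfl, hp⟩
  · push Not at hp
    obtain ⟨n, hn⟩ := hp
    refine ⟨h⁻¹, .inr rfl, fun m => ?_⟩
    exact hδ.left_le (hh.gromovProduct_le m n) (by rwa [gromovProduct_comm])

theorem IsAxial.point_ne_point (hδ : FourPoint X δ) {C' B : ℝ} {k : X ≃ᵢ X} (hk : IsAxial x₀ C k)
    (hh : IsAxial x₀ C' h) {g : X ≃ᵢ X} {x : X}
    (hB : ∀ n : ℕ, gromovProduct x (g ((k ^ n) x₀)) ((h ^ n) x₀) ≤ B) :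
    GromovBoundary.map g hk.point ≠ hh.point := by
  intro heq
  have := (InfSeq.mk_eq_iff hδ).1 heq x
  obtain ⟨n, hn⟩ := (this.eventually_gt_atTop B).exists
  exact absurd (hB n) (not_le.2 hn)

theorem IsAxial.point_ne_point_inv (hδ : FourPoint X δ) (hh : IsAxial x₀ C h) :
    hh.point ≠ hh.inv.point := by
  intro heq
  obtain ⟨n, hn⟩ := (((InfSeq.mk_eq_iff hδ).1 heq x₀).eventually_gt_atTop C).exists
  have := hh.gromovProduct_le n n
  rw [gromovProduct_comm] at this
  exact absurd this (not_le.2 hn)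

/-- Every orbit segment `[x₀, g x₀]` which is not short is close to a translate of the axis. -/
theorem IsAxial.exists_translate (hδ : FourPoint X δ) (hpos : 0 < δ) {G : Subgroup (X ≃ᵢ X)}
    (htrans : IsTransitiveOnLimitPairs G) (hh : IsAxial x₀ C h) (hG : h ∈ G) :
    ∃ R : ℝ, ∀ g ∈ G, dist (g x₀) x₀ ≤ R ∨ ∃ u ∈ G, ∃ i j : ℤ,
      dist x₀ (u ((h ^ i) x₀)) ≤ R ∧ dist (g x₀) (u ((h ^ j) x₀)) ≤ R := by
  set R₁ := 2 * (C + δ) + δ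
  set R₂ := 2 * ((C + δ + δ + δ + δ) + δ + dist (h x₀) x₀) + C
  refine ⟨max R₁ R₂, fun g hg => ?_⟩
  rcases le_or_gt (dist (g x₀) x₀) R₁ with hle | hgt
  · exact .inl (hle.trans (le_max_left _ _))
  right
  obtain ⟨k, hk, hkp⟩ := hh.exists_forall_gromovProduct_le hδ (g x₀)
  obtain ⟨k', hk', hkp'⟩ := hh.exists_forall_gromovProduct_le hδ (g⁻¹ x₀)
  have hkA : IsAxial x₀ C k := by rcases hk with rfl | rfl; exacts [hh, hh.inv]
  have hkA' : IsAxial x₀ C k' := by rcases hk' with rfl | rfl; exacts [hh, hh.inv]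
  have hkG : k ∈ G := by rcases hk with rfl | rfl; exacts [hG, G.inv_mem hG]
  have hkG' : k' ∈ G := by rcases hk' with rfl | rfl; exacts [hG, G.inv_mem hG]
  have hkq : ∀ n : ℕ, gromovProduct (g x₀) (g ((k' ^ n) x₀)) x₀ ≤ C + δ := fun n => by
    rw [gromovProduct_inv_apply, IsometryEquiv.inv_apply_self]
    exact hkp' n
  -- The end of `k` and the end of `g k' g⁻¹` are separated, as seen from `x₀` and from `g x₀`.
  have hsep : ∀ n : ℕ, gromovProduct x₀ (g ((k' ^ n) x₀)) ((k ^ n) x₀) ≤ C + δ + δ := fun n => by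
    have h1 := gromovProduct_add_swap x₀ (g x₀) (g ((k' ^ n) x₀))
    rw [gromovProduct_comm (g x₀), dist_comm] at h1
    rw [gromovProduct_comm]
    exact hδ.left_le (hkp n) (by rw [gromovProduct_comm]; linarith [hkq n])
  have hsep' : ∀ n : ℕ, gromovProduct (g x₀) (g ((k' ^ n) x₀)) ((k ^ n) x₀) ≤ C + δ + δ :=
    fun n => by
      have h1 := gromovProduct_add_swap x₀ (g x₀) ((k ^ n) x₀)
      rw [gromovProduct_comm x₀, dist_comm, gromovProduct_comm (g x₀)] at h1
      exact hδ.left_le (hkq n) (by linarith [hkp n])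
  obtain ⟨u, hu, hu1, hu2⟩ := htrans _ (hh.point_mem hG) _ (hh.inv.point_mem (G.inv_mem hG)) _
    (hkA'.map_point_mem hkG' hg) _ (hkA.point_mem hkG) (hh.point_ne_point_inv hδ)
    (hkA'.point_ne_point hδ hkA hsep)
  have hclose : ∀ x : X,
      (∀ n : ℕ, gromovProduct x (g ((k' ^ n) x₀)) ((k ^ n) x₀) ≤ C + δ + δ) →
      ∃ j : ℤ, dist x (u ((h ^ j) x₀)) ≤ R₂ := by
    intro x hx
    obtain ⟨n, hn1, hn2⟩ :=
      ((((InfSeq.mk_eq_iff hδ).1 hu1 x).eventually_gt_atTop (C + δ + δ + δ + δ)).and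
      (((InfSeq.mk_eq_iff hδ).1 hu2 x).eventually_gt_atTop (C + δ + δ + δ + δ))).exists
    change _ < gromovProduct x (u ((h ^ n) x₀)) (g ((k' ^ n) x₀)) at hn1
    change _ < gromovProduct x (u ((h⁻¹ ^ n) x₀)) ((k ^ n) x₀) at hn2
    have h1 : gromovProduct x (u ((h ^ n) x₀)) ((k ^ n) x₀) ≤ C + δ + δ + δ :=
      hδ.right_le (hx n) (by rw [gromovProduct_comm]; linarith)
    have h2 : gromovProduct x (u ((h ^ n) x₀)) (u ((h⁻¹ ^ n) x₀)) ≤ C + δ + δ + δ + δ :=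
      hδ.left_le h1 (by linarith)
    have h3 : gromovProduct (u⁻¹ x) ((h ^ n) x₀) ((h⁻¹ ^ n) x₀) ≤ C + δ + δ + δ + δ := by
      rwa [gromovProduct_inv_apply, inv_inv]
    obtain ⟨j, hj⟩ := hh.exists_dist_le hδ hpos h3
    exact ⟨j, by rwa [dist_inv_apply] at hj⟩
  obtain ⟨i, hi⟩ := hclose x₀ hsep
  obtain ⟨j, hj⟩ := hclose (g x₀) hsep'
  exact ⟨u, hu, i, j, hi.trans (le_max_right _ _), hj.trans (le_max_right _ _)⟩

/-- An isometry `s` exchanging the ends of the axis conjugates `hⁿ` to `h⁻ⁿ` up to a bounded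
error. -/
theorem IsAxial.exists_swap (hδ : FourPoint X δ) {G : Subgroup (X ≃ᵢ X)}
    (htrans : IsTransitiveOnLimitPairs G) (hh : IsAxial x₀ C h) (hG : h ∈ G) :
    ∃ s ∈ G, ∃ R : ℝ, ∀ n : ℕ, dist ((h ^ n * s * h ^ n) x₀) x₀ ≤ R := by
  obtain ⟨s, hs, hs1, -⟩ := htrans _ (hh.point_mem hG) _ (hh.inv.point_mem (G.inv_mem hG)) _
    (hh.inv.point_mem (G.inv_mem hG)) _ (hh.point_mem hG) (hh.point_ne_point_inv hδ)
    (hh.point_ne_point_inv hδ).symm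
  refine ⟨s, hs, 3 * dist (s x₀) x₀ + 2 * C + 4 * δ, fun n => ?_⟩
  obtain ⟨m, hm, hnm⟩ := ((((InfSeq.mk_eq_iff hδ).1 hs1 x₀).eventually_gt_atTop
    (dist ((h ^ n) x₀) x₀)).and (eventually_ge_atTop n)).exists
  change _ < gromovProduct x₀ (s ((h ^ m) x₀)) ((h⁻¹ ^ m) x₀) at hm
  have h1 := hh.le_gromovProduct hnm
  have h2 := hh.inv.le_gromovProduct hnm
  rw [inv_pow, dist_inv_self, ← inv_pow] at h2
  rw [← gromovProduct_map s] at h1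
  have h3 := gromovProduct_le_add_dist_base (s x₀) x₀ (s ((h ^ n) x₀)) (s ((h ^ m) x₀))
  have hC0 := (gromovProduct_nonneg _ _ _).trans (hh.gromovProduct_le 0 0)
  have hs0 := dist_nonneg (x := s x₀) (y := x₀)
  have h4 := hδ.le (B := dist ((h ^ n) x₀) x₀ - C - dist (s x₀) x₀) (w := x₀)
    (x := s ((h ^ n) x₀)) (y := s ((h ^ m) x₀)) (z := (h⁻¹ ^ m) x₀) (by linarith) (by linarith)
  have hδ0 : 0 ≤ δ := by
    have := hδ x₀ x₀ x₀ x₀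
    simpa [gromovProduct_self] using this
  have h5 := hδ.le (B := dist ((h ^ n) x₀) x₀ - C - dist (s x₀) x₀ - δ) (w := x₀)
    (x := s ((h ^ n) x₀)) (y := (h⁻¹ ^ m) x₀) (z := (h⁻¹ ^ n) x₀) h4
    (by rw [gromovProduct_comm]; linarith)
  have h6 : dist (s ((h ^ n) x₀)) ((h⁻¹ ^ n) x₀) = dist ((h ^ n * s * h ^ n) x₀) x₀ := by
    rw [dist_comm, inv_pow, dist_inv_apply, dist_comm]; rfl
  have h7 := dist_triangle (s ((h ^ n) x₀)) (s x₀) x₀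
  rw [s.dist_eq] at h7
  have h8 : dist ((h⁻¹ ^ n) x₀) x₀ = dist ((h ^ n) x₀) x₀ := by rw [inv_pow, dist_inv_self]
  rw [gromovProduct] at h5
  linarith

end Axis

end HypSpace

/-! ### Compactness in the isometry group -/

namespace HypSpace

variable {X : Type*} [MetricSpace X]

/-- In the isometry group the compact open topology is that of pointwise convergence. -/
theorem tendsto_isometryEquiv {ι : Type*} {l : Filter ι} {F : ι → X ≃ᵢ X} {f : X ≃ᵢ X}
    (h : ∀ x, Tendsto (fun i => F i x) l (𝓝 (f x))) : Tendsto F l (𝓝 f) := by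
  rw [nhds_induced, tendsto_comap_iff]
  refine ContinuousMap.tendsto_of_tendstoLocallyUniformly (Metric.tendstoLocallyUniformly_iff.2 ?_)
  intro ε hε x
  refine ⟨Metric.ball x (ε / 3), Metric.ball_mem_nhds x (by positivity), ?_⟩
  filter_upwards [Metric.tendsto_nhds.1 (h x) (ε / 3) (by positivity)] with i hi y hy
  have h1 := (F i).dist_eq x y
  have h2 := f.dist_eq y x
  have h3 := dist_triangle4 (f y) (f x) (F i x) (F i y)
  rw [Metric.mem_ball] at hy
  rw [dist_comm] at hi
  rw [dist_comm x y] at h1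
  change dist (f y) (F i y) < ε
  linarith

variable [ProperSpace X]

theorem isCompact_setOf_dist_le (x₀ : X) (R : ℝ) :
    IsCompact {g : X ≃ᵢ X | dist (g x₀) x₀ ≤ R} := by
  refine isCompact_iff_ultrafilter_le_nhds.2 fun U hU => ?_
  have hU : ∀ᶠ g in (U : Filter (X ≃ᵢ X)), dist (g x₀) x₀ ≤ R := le_principal_iff.1 hU
  have hlim : ∀ (F : (X ≃ᵢ X) → X ≃ᵢ X), (∀ g, dist (F g x₀) x₀ = dist (g x₀) x₀) →
      ∀ x, ∃ y, Tendsto (fun g => F g x) (U : Filter (X ≃ᵢ X)) (𝓝 y) := by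
    intro F hF x
    obtain ⟨y, -, hy⟩ := (isCompact_closedBall x₀ (dist x x₀ + R)).ultrafilter_le_nhds
      (U.map fun g => F g x) (by
        refine le_principal_iff.2 (?_ : ∀ᶠ g in (U : Filter (X ≃ᵢ X)), F g x ∈ _)
        filter_upwards [hU] with g hg
        have h1 := dist_triangle (F g x) (F g x₀) x₀
        rw [(F g).dist_eq, hF] at h1
        exact Metric.mem_closedBall.2 (by linarith))
    exact ⟨y, hy⟩
  choose f hf using hlim id fun _ => rfl
  -- The inverses converge as well, and their limit is the inverse of the limit.
  choose f' hf' using hlim (fun g => g⁻¹) fun g => dist_inv_self g x₀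
  have hff' : ∀ x, f (f' x) = x := fun x => by
    refine tendsto_nhds_unique (hf (f' x)) (tendsto_iff_dist_tendsto_zero.2 ?_)
    refine (tendsto_iff_dist_tendsto_zero.1 (hf' x)).congr fun g => ?_
    rw [dist_inv_apply, dist_comm]; rfl
  have hiso : Isometry f := Isometry.of_dist_eq fun x y =>
    tendsto_nhds_unique ((hf x).dist (hf y)) (by simp [IsometryEquiv.dist_eq])
  let e : X ≃ᵢ X := IsometryEquiv.mk' f f' hff' hiso
  refine ⟨e, ?_, ?_⟩
  · exact le_of_tendsto ((hf x₀).dist tendsto_const_nhds) hU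
  · exact tendsto_isometryEquiv (F := id) (l := (U : Filter (X ≃ᵢ X))) (f := e) hf

theorem isCompact_setOf_dist_le_of_isClosed {G : Subgroup (X ≃ᵢ X)}
    (hG : IsClosed (G : Set (X ≃ᵢ X))) (x₀ : X) (R : ℝ) :
    IsCompact {g : G | dist ((g : X ≃ᵢ X) x₀) x₀ ≤ R} :=
  (IsClosed.isClosedEmbedding_subtypeVal hG).isCompact_preimage (isCompact_setOf_dist_le x₀ R)

end HypSpace

/-! ### Quasimorphisms and the comparison map -/

namespace ContCohom

open HypSpace

/-- Every continuous quasimorphism is bounded, because `G` is the product of a compact set, the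
powers of an axial element and a compact set. -/
theorem IsContQuasimorphism.bounded {X : Type*} [MetricSpace X] [ProperSpace X]
    (hX : IsHyperbolicGeodesicSpace X) {G : Subgroup (X ≃ᵢ X)}
    (hclosed : IsClosed (G : Set (X ≃ᵢ X))) (hne : ¬ IsElementary G)
    (htrans : IsTransitiveOnLimitPairs G) {q : G → ℝ} (hq : IsContQuasimorphism q) :
    ∃ C : ℝ, ∀ g : G, |q g| ≤ C := by
  obtain ⟨hgeo, δ₀, hδ₀, hthin⟩ := hX
  have hδ := fourPoint_of_hasThinTriangles hgeo hδ₀ hthin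
  have hpos : 0 < 3 * δ₀ := by positivity
  obtain ⟨ξ, η, hξ, hη, hξη⟩ := Set.one_lt_encard_iff.1
    (lt_trans (by norm_num) (not_le.1 hne : 2 < (limitSet G).encard))
  obtain ⟨x₀, -⟩ := id hξ
  obtain ⟨h, hG, C, hh⟩ := exists_isAxial hδ hpos hξ hη hξη x₀
  obtain ⟨R, hR⟩ := hh.exists_translate hδ hpos htrans hG
  obtain ⟨s, hs, R', hR'⟩ := hh.exists_swap hδ htrans hG
  obtain ⟨hcont, D, hD⟩ := hq
  have hcpt : ∀ R : ℝ, ∃ M : ℝ, ∀ g : G, dist ((g : X ≃ᵢ X) x₀) x₀ ≤ R → |q g| ≤ M := fun R =>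
    (isCompact_setOf_dist_le_of_isClosed hclosed x₀ R).exists_bound_of_continuousOn
      hcont.continuousOn
  obtain ⟨M, hM⟩ := hcpt R
  obtain ⟨M', hM'⟩ := hcpt R'
  lift h to G using hG
  lift s to G using hs
  have hprod : ∀ a b : G, |q (a * b)| ≤ |q a| + |q b| + D := fun a b => by
    have h1 := abs_le.1 (hD a b)
    have h2 := le_abs_self (q a)
    have h3 := neg_abs_le (q a)
    have h4 := le_abs_self (q b)
    have h5 := neg_abs_le (q b)
    exact abs_le.2 ⟨by linarith, by linarith⟩
  have hinv : ∀ a : G, |q a⁻¹| ≤ |q a| + |q 1| + D := fun a => by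
    have h1 := abs_le.1 (hD a a⁻¹)
    rw [mul_inv_cancel] at h1
    have h2 := le_abs_self (q a)
    have h3 := neg_abs_le (q a)
    have h4 := le_abs_self (q 1)
    have h5 := neg_abs_le (q 1)
    exact abs_le.2 ⟨by linarith, by linarith⟩
  -- The element `hⁿ s hⁿ` stays in a compact set, while `q (hⁿ s hⁿ)` is `2 q (hⁿ)` up to a
  -- bounded error.
  have hpow : ∀ n : ℕ, |q (h ^ n)| ≤ |q s| + M' + 2 * D := fun n => by
    have h0 := abs_le.1 (hM' (h ^ n * s * h ^ n) (hR' n))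
    have h1 := abs_le.1 (hD (h ^ n * s) (h ^ n))
    have h2 := abs_le.1 (hD (h ^ n) s)
    have h3 := le_abs_self (q s)
    have h4 := neg_abs_le (q s)
    have h5 := abs_nonneg (q s)
    exact abs_le.2 ⟨by linarith, by linarith⟩
  have hzpow : ∀ n : ℤ, |q (h ^ n)| ≤ |q s| + M' + 2 * D + |q 1| + D := fun n => by
    have hD0 := (abs_nonneg _).trans (hD 1 1)
    have h1 := abs_nonneg (q 1)
    obtain ⟨n, rfl | rfl⟩ := n.eq_nat_or_neg
    · rw [zpow_natCast]; linarith [hpow n]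
    · rw [zpow_neg, zpow_natCast]; linarith [hinv (h ^ n), hpow n]
  refine ⟨max M (M + (|q s| + M' + 2 * D + |q 1| + D) + D + (M + |q 1| + D) + D), fun g => ?_⟩
  rcases hR g g.2 with hg | ⟨u, hu, i, j, hi, hj⟩
  · exact (hM g hg).trans (le_max_left _ _)
  · refine le_trans ?_ (le_max_right _ _)
    lift u to G using hu
    have h1 : |q (u * h ^ i)| ≤ M := hM _ (by rw [dist_comm]; exact hi)
    have h2 : |q (g⁻¹ * (u * h ^ j))| ≤ M := hM _ (by
      change dist ((g : X ≃ᵢ X)⁻¹ ((u : X ≃ᵢ X) (((h : X ≃ᵢ X) ^ j) x₀))) x₀ ≤ R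
      rwa [dist_inv_apply, dist_comm])
    have h3 : g = u * h ^ i * h ^ (j - i) * (g⁻¹ * (u * h ^ j))⁻¹ := by
      rw [mul_assoc u, ← zpow_add, add_sub_cancel]; group
    rw [h3]
    linarith [hprod (u * h ^ i * h ^ (j - i)) (g⁻¹ * (u * h ^ j))⁻¹,
      hprod (u * h ^ i) (h ^ (j - i)), hinv (g⁻¹ * (u * h ^ j)), hzpow (j - i)]

/-- If continuous quasimorphisms are bounded then the comparison map is injective in degree two: a
continuous primitive of a bounded cocycle is, as a function on `G`, a quasimorphism. -/
theorem comparison_injective_of_bounded {G : Type*} [Group G] [TopologicalSpace G]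
    (hG : ∀ q : G → ℝ, IsContQuasimorphism q → ∃ C : ℝ, ∀ g : G, |q g| ≤ C) :
    Function.Injective (comparison G 2) := by
  refine (injective_iff_map_eq_zero _).2 fun a ha => ?_
  obtain ⟨⟨ω, hω⟩, rfl⟩ := Submodule.Quotient.mk_surjective _ a
  obtain ⟨β, ⟨hβc, hβi⟩, hβ⟩ : ω ∈ coboundaries (contCochains G) 2 :=
    (Submodule.Quotient.mk_eq_zero
      ((coboundaries (contCochains G) 2).submoduleOf (cocycles (contCochains G) 2))).1 ha
  change coboundary G 1 β = ω at hβ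
  refine (Submodule.Quotient.mk_eq_zero _).2
    (?_ : ω ∈ coboundaries (bddContCochains G) 2)
  obtain ⟨A, hA⟩ := hω.1.2
  have hval : ∀ g : Fin 2 → G, β g = β ![1, (g 0)⁻¹ * g 1] := fun g => by
    rw [← hβi (g 0)⁻¹ g]
    congr 1
    funext i
    fin_cases i <;> simp
  have hq : IsContQuasimorphism fun g : G => β ![1, g] := by
    refine ⟨hβc.comp (by fun_prop), A, fun g h => ?_⟩
    have e0 : (fun j => (![1, g, g * h] : Fin 3 → G) (Fin.succAbove 0 j)) = ![g, g * h] := by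
      funext i; fin_cases i <;> rfl
    have e1 : (fun j => (![1, g, g * h] : Fin 3 → G) (Fin.succAbove 1 j)) = ![1, g * h] := by
      funext i; fin_cases i <;> rfl
    have e2 : (fun j => (![1, g, g * h] : Fin 3 → G) (Fin.succAbove 2 j)) = ![1, g] := by
      funext i; fin_cases i <;> rfl
    have e3 : β ![g, g * h] = β ![1, h] := by
      rw [hval]; simp
    have hd : coboundary G 1 β ![1, g, g * h] = β ![1, g] + β ![1, h] - β ![1, g * h] := by
      change ∑ i : Fin 3, (-1) ^ (i : ℕ) *
        β (fun j => (![1, g, g * h] : Fin 3 → G) (Fin.succAbove i j)) = _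
      rw [Fin.sum_univ_three, e0, e1, e2, e3]
      simp
      ring
    rw [← hd, hβ]
    exact hA _
  obtain ⟨C, hC⟩ := hG _ hq
  exact ⟨β, ⟨⟨hβc, hβi⟩, C, fun g => by rw [hval]; exact hC _⟩, hβ⟩

end ContCohom

theorem theoremB {X : Type*} [MetricSpace X] [ProperSpace X]
    (hX : HypSpace.IsHyperbolicGeodesicSpace X)
    (G : Subgroup (X ≃ᵢ X)) (hclosed : IsClosed (G : Set (X ≃ᵢ X)))
    (hne : ¬ HypSpace.IsElementary G)
    (htrans : HypSpace.IsTransitiveOnLimitPairs G) :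
    Function.Injective (ContCohom.comparison G 2) ∧
      ∀ q : G → ℝ, ContCohom.IsContQuasimorphism q → ∃ C : ℝ, ∀ g : G, |q g| ≤ C := by
  have hbdd : ∀ q : G → ℝ, ContCohom.IsContQuasimorphism q → ∃ C : ℝ, ∀ g : G, |q g| ≤ C :=
    fun _ hq => hq.bounded hX hclosed hne htrans
  exact ⟨ContCohom.comparison_injective_of_bounded hbdd, hbdd⟩
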